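/- Let $n\ge 1$ be an integer and $q>2$ a prime power with $(n,q)\neq(1,3)$. Put $F=GF(q)$, $K=GF(q^{n+1})$, let $N:K\to F$ be the norm, and regard $PG(2n+1,q)$ as the projective space of the $F$-vector space $K\oplus K$. A collineation is a permutation of the points that preserves collinearity in both directions; maps are written on the right, and $x^\rho$ denotes the image of $x$ under a field automorphism $\rho$. For $\sigma\in Aut(K/F)$, $k\in K$ and $f\in F^*$ let $$J^\sigma(k)=\{(kx^\sigma,x):x\in K\},\qquad \mathcal J^\sigma_f=\{J^\sigma(k): N(k)=f\},\qquad \mathcal J_f=\mathcal J^{1}_f,$$ $$\mathcal L=\{\mathcal J_f: f\in F^*\},\qquad \mathcal J=\{\mathcal J^\sigma_f:\sigma\in Aut(K/F),\ f\in F^*\}.$$ For $\rho\in Aut(K)$ and $a,b,c,d\in K$ with $ad-bc\ne 0$ let $\chi_{a,b,c,d,\rho}$ be the collineation induced by $(x,y)\mapsto(ax^\rho+cy^\rho,\;bx^\rho+dy^\rho)$, and for $\sigma\in Aut(K/F)$ let $\lambda_\sigma$ be the collineation induced by $(x,y)\mapsto(x,y^\sigma)$. Say that the permutation group induced by a group on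 a set $X$ is action-isomorphic, along a bijection $X\to Y$, to a permutation group on $Y$ if there is a group isomorphism between the two permutation groups that is compatible with the bijection. Then: 1. The group of all collineations of $PG(2n+1,q)$ leaving $\mathcal L$ invariant is $$G_{\mathcal L}=\{\chi_{a,0,0,d,\mu}: a,d\in K^*,\ \mu\in Aut(K)\}\cup\{\chi_{0,b,c,0,\mu}: b,c\in K^*,\ \mu\in Aut(K)\}.$$ 2. The map $f\mapsto\mathcal J_f$ is a bijection from $F^*$ to $\mathcal L$, and along it the permutation action of $G_{\mathcal L}$ on $\mathcal L$ is action-isomorphic to the group $\Xi$ of all transformations $\xi^{\pm}_{\alpha,\tau}$, $\alpha\in F^*$, $\tau\in Aut(F)$, acting via $(\mathcal J_f)^{\xi^{\pm}_{\alpha,\tau}}=\mathcal J_{\alpha f^{\pm\tau}}$, where $f^{\pm\tau}=(f^\tau)^{\pm1}$. 3. The group of all collineations of $PG(2n+1,q)$ leaving $\mathcal J$ invariant is $$G_{\mathcal J}=\{\chi\lambda_\sigma:\chi\in G_{\mathcal L},\ \sigma\in Aut(K/F)\}.$$ 4. The map $(\rho,f)\mapsto\mathcal J^\rho_f$ is a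 bijection from $Aut(K/F)\times F^*$ to $\mathcal J$, and along it the permutation action of $G_{\mathcal J}$ on $\mathcal J$ is action-isomorphic to the group $\Upsilon$ of all transformations $\upsilon^{\pm}_{\alpha,\tau,\sigma}$, $\alpha\in F^*$, $\tau\in Aut(F)$, $\sigma\in Aut(K/F)$, acting via $(\mathcal J^\rho_f)^{\upsilon^{\pm}_{\alpha,\tau,\sigma}}=\mathcal J^{\rho^{\pm1}\sigma^{-1}}_{\alpha f^{\pm\tau}}$, with the same sign in both places. -/

import Mathlib

open Projectivization
open scoped LinearAlgebra.Projectivization Pointwise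

namespace Andre

section Collineations

variable (F V : Type*) [Field F] [AddCommGroup V] [Module F V]

/-- The collineation group of the projective space `ℙ F V`: the permutations of its points that
preserve collinearity in both directions. -/
def Collineation : Subgroup (Equiv.Perm (ℙ F V)) where
  carrier := {φ | ∀ S : Set (ℙ F V), IsCollinear (φ '' S) ↔ IsCollinear S}
  mul_mem' := by
    intro φ ψ hφ hψ S
    rw [Equiv.Perm.coe_mul, Set.image_comp, hφ, hψ]
  one_mem' := by
    intro S
    simp
  inv_mem' := by
    intro φ hφ S
    rw [← hφ, ← Set.image_comp]
    simp

variable {F V}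

theorem isCollinear_image_of_semilinear {σ : F →+* F} (hσ : Function.Bijective σ)
    (T : V →ₛₗ[σ] V) (hT : Function.Bijective T) {S : Set (ℙ F V)} :
    IsCollinear (Projectivization.map T hT.1 '' S) ↔ IsCollinear S := by
  have : RingHomSurjective σ := ⟨hσ.2⟩
  have key : ∀ M : Submodule F V, Module.rank F M = Module.rank F (M.map T) := by
    intro M
    let j : M ≃+ M.map T := AddEquiv.ofBijective
      (({ toFun := fun x => ⟨T x, Submodule.mem_map_of_mem x.2⟩
          map_zero' := by ext; simp
          map_add' := by intro x y; ext; simp } : M →+ M.map T)) (by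
        constructor
        · intro x y h
          exact Subtype.ext (hT.1 (congrArg Subtype.val h))
        · rintro ⟨y, x, hx, rfl⟩
          exact ⟨⟨x, hx⟩, rfl⟩)
    refine rank_eq_of_equiv_equiv σ j hσ ?_
    intro r m
    apply Subtype.ext
    change T (r • (m : V)) = σ r • T m
    simp
  rw [IsCollinear_iff_rank, IsCollinear_iff_rank]
  constructor
  · rintro ⟨M, hM, hS⟩
    refine ⟨(M.submodule.comap T).projectivization, ?_, ?_⟩
    · rw [Subspace.submodule.apply_symm_apply, key,
        Submodule.map_comap_eq_of_surjective hT.2]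
      exact hM
    · intro p hp
      have h := hS (Set.mem_image_of_mem _ hp)
      induction p using Projectivization.ind with | h v hv =>
      rw [Projectivization.map_mk] at h
      exact (Submodule.mk_mem_projectivization_iff ..).2
        ((Subspace.mem_submodule_iff ..).2 h)
  · rintro ⟨M, hM, hS⟩
    refine ⟨(M.submodule.map T).projectivization, ?_, ?_⟩
    · rw [Subspace.submodule.apply_symm_apply, ← key]
      exact hM
    · rintro _ ⟨p, hp, rfl⟩
      have h := hS hp
      induction p using Projectivization.ind with | h v hv =>
      rw [Projectivization.map_mk]
      refine (Submodule.mk_mem_projectivization_iff ..).2 (Submodule.mem_map_of_mem ?_)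
      exact (Subspace.mem_submodule_iff ..).2 h

/-- The collineation `[v] ↦ [T v]` induced by a bijective semilinear map `T`. -/
noncomputable def ofSemilinear (σ : F →+* F) (hσ : Function.Bijective σ)
    (T : V →ₛₗ[σ] V) (hT : Function.Bijective T) : Collineation F V :=
  ⟨Equiv.ofBijective (Projectivization.map T hT.1) (by
    refine ⟨?_, ?_⟩
    · intro p q h
      induction p using Projectivization.ind with | h v hv =>
      induction q using Projectivization.ind with | h w hw =>
      rw [Projectivization.map_mk, Projectivization.map_mk, mk_eq_mk_iff'] at h
      obtain ⟨a, ha⟩ := h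
      obtain ⟨b, rfl⟩ := hσ.2 a
      rw [mk_eq_mk_iff']
      refine ⟨b, hT.1 ?_⟩
      rw [map_smulₛₗ, ha]
    · intro p
      induction p using Projectivization.ind with | h v hv =>
      obtain ⟨w, rfl⟩ := hT.2 v
      exact ⟨mk F w (by rintro rfl; simp at hv), Projectivization.map_mk ..⟩),
    fun _ => isCollinear_image_of_semilinear hσ T hT⟩

end Collineations

section Model

variable {F K : Type*} [Field F] [Field K] [Finite K] [Algebra F K]

theorem exists_restrict (F : Type*) [Field F] [Algebra F K] (ρ : K ≃+* K) :
    ∃ σ : F →+* F, ∀ f, algebraMap F K (σ f) = ρ (algebraMap F K f) := by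
  have : Finite F := Finite.of_injective _ (algebraMap F K).injective
  let _ := Fintype.ofFinite F
  have h : ∀ f : F, ∃ g : F, algebraMap F K g = ρ (algebraMap F K f) := by
    intro f
    have hfix : ∀ s : Gal(K/F), s (ρ (algebraMap F K f)) = ρ (algebraMap F K f) := by
      intro s
      obtain ⟨m, hm⟩ := (FiniteField.bijective_frobeniusAlgEquivOfAlgebraic_pow F K).2 s
      have hq : (fun x : K => x ^ Fintype.card F) (ρ (algebraMap F K f))
          = ρ (algebraMap F K f) := by
        simp only [← map_pow, FiniteField.pow_card]
      rw [← hm]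
      simp only [AlgEquiv.coe_pow, FiniteField.coe_frobeniusAlgEquivOfAlgebraic]
      exact Function.iterate_fixed hq _
    exact (IsGalois.mem_range_algebraMap_iff_fixed (F := F) (E := K) _).2 hfix
  choose g hg using h
  refine ⟨⟨⟨⟨g, ?_⟩, ?_⟩, ?_, ?_⟩, hg⟩
  all_goals
    intros
    apply (algebraMap F K).injective
    simp [hg]

/-- The map `(x, y) ↦ (a x^ρ + c y^ρ, b x^ρ + d y^ρ)` on `K ⊕ K`, where `ρ` is an automorphism
of `K`. -/
def chiFun (a b c d : K) (ρ : K ≃+* K) (v : K × K) : K × K :=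
  (a * ρ v.1 + c * ρ v.2, b * ρ v.1 + d * ρ v.2)

theorem chiFun_bijective (a b c d : K) (ρ : K ≃+* K) (h : a * d - b * c ≠ 0) :
    Function.Bijective (chiFun a b c d ρ) := by
  rw [← Finite.injective_iff_bijective]
  rintro ⟨x, y⟩ ⟨z, w⟩ e
  simp only [chiFun, Prod.mk.injEq] at e
  obtain ⟨e1, e2⟩ := e
  have hx : (a * d - b * c) * (ρ x - ρ z) = 0 := by linear_combination d * e1 - c * e2
  have hy : (a * d - b * c) * (ρ y - ρ w) = 0 := by linear_combination a * e2 - b * e1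
  have hx' := ρ.injective (sub_eq_zero.1 ((mul_eq_zero.1 hx).resolve_left h))
  have hy' := ρ.injective (sub_eq_zero.1 ((mul_eq_zero.1 hy).resolve_left h))
  rw [hx', hy']

variable (F) in
/-- The restriction to `F` of an automorphism of `K`. -/
noncomputable def restrictF (ρ : K ≃+* K) : F →+* F := (exists_restrict F ρ).choose

theorem algebraMap_restrictF (ρ : K ≃+* K) (f : F) :
    algebraMap F K (restrictF F ρ f) = ρ (algebraMap F K f) := (exists_restrict F ρ).choose_spec f

variable (F) in
/-- The collineation `χ_{a,b,c,d,ρ}` of `PG(2n+1,q) = ℙ F (K × K)` induced by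
`(x, y) ↦ (a x^ρ + c y^ρ, b x^ρ + d y^ρ)`, where `ad - bc ≠ 0` and `ρ ∈ Aut(K)`. -/
noncomputable def chi (a b c d : K) (ρ : K ≃+* K) (h : a * d - b * c ≠ 0) :
    Collineation F (K × K) :=
  ofSemilinear (restrictF F ρ)
    (by
      have : Finite F := Finite.of_injective _ (algebraMap F K).injective
      exact Finite.injective_iff_bijective.1 (restrictF F ρ).injective)
    { toFun := chiFun a b c d ρ
      map_add' := by
        intro v w
        simp only [chiFun, Prod.fst_add, Prod.snd_add, map_add, Prod.mk_add_mk, Prod.mk.injEq]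
        constructor <;> ring
      map_smul' := by
        intro f v
        simp only [chiFun, Prod.smul_fst, Prod.smul_snd, Prod.smul_mk, Prod.mk.injEq]
        simp only [Algebra.smul_def, map_mul, algebraMap_restrictF]
        constructor <;> ring }
    (chiFun_bijective a b c d ρ h)

theorem chi_mk (a b c d : K) (ρ : K ≃+* K) (h : a * d - b * c ≠ 0) (v : K × K) (hv : v ≠ 0)
    (hw : (a * ρ v.1 + c * ρ v.2, b * ρ v.1 + d * ρ v.2) ≠ (0 : K × K)) :
    (chi F a b c d ρ h : Equiv.Perm (ℙ F (K × K))) (mk F v hv) =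
      mk F (a * ρ v.1 + c * ρ v.2, b * ρ v.1 + d * ρ v.2) hw := rfl

/-- The collineation `λ_σ` of `ℙ F (K × K)` induced by `(x, y) ↦ (x, y^σ)`, for
`σ ∈ Aut(K/F)`. -/
noncomputable def lam (σ : K ≃ₐ[F] K) : Collineation F (K × K) :=
  ofSemilinear (RingHom.id F) Function.bijective_id
    (LinearMap.prodMap LinearMap.id σ.toLinearMap)
    (Function.Bijective.prodMap Function.bijective_id σ.bijective)

theorem lam_mk (σ : K ≃ₐ[F] K) (v : K × K) (hv : v ≠ 0) (hw : (v.1, σ v.2) ≠ (0 : K × K)) :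
    (lam σ : Equiv.Perm (ℙ F (K × K))) (mk F v hv) = mk F (v.1, σ v.2) hw := rfl

/-- The subspace `J^σ(k) = {(k x^σ, x) : x ∈ K}` of `PG(2n+1,q)`, as a set of points. -/
def J (σ : K ≃ₐ[F] K) (k : K) : Set (ℙ F (K × K)) :=
  {p | ∃ (x : K) (h : (k * σ x, x) ≠ (0 : K × K)), p = mk F (k * σ x, x) h}

/-- The set of subspaces `J^σ_f = {J^σ(k) : N(k) = f}`, with `N` the norm from `K` to `F`. For
`σ = 1` this is the norm surface `J_f` of the regular spread. -/
def normSurface (σ : K ≃ₐ[F] K) (f : Fˣ) : Set (Set (ℙ F (K × K))) :=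
  {U | ∃ k : K, Algebra.norm F k = (f : F) ∧ U = J σ k}

variable (F K) in
/-- The linear set `L = {J_f : f ∈ F*}`. -/
def linearSet : Set (Set (Set (ℙ F (K × K)))) :=
  Set.range fun f : Fˣ => normSurface (1 : K ≃ₐ[F] K) f

variable (F K) in
/-- The collection `𝒥 = {J^σ_f : σ ∈ Aut(K/F), f ∈ F*}`. -/
def allSurfaces : Set (Set (Set (ℙ F (K × K)))) :=
  Set.range fun x : (K ≃ₐ[F] K) × Fˣ => normSurface x.1 x.2

variable (F K) in
/-- The collineations `χ_{a,0,0,d,μ}` (`ad ≠ 0`) and `χ_{0,b,c,0,μ}` (`bc ≠ 0`), `μ ∈ Aut(K)`. -/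
def collL : Set (Collineation F (K × K)) :=
  {φ | ∃ (a d : K) (μ : K ≃+* K) (h : a * d - 0 * 0 ≠ 0), φ = chi F a 0 0 d μ h} ∪
  {φ | ∃ (b c : K) (μ : K ≃+* K) (h : 0 * 0 - b * c ≠ 0), φ = chi F 0 b c 0 μ h}

variable (F K) in
/-- The collineations `χ λ_σ` (first `χ`, then `λ_σ`) with `χ ∈ collL` and `σ ∈ Aut(K/F)`. -/
def collJ : Set (Collineation F (K × K)) :=
  {φ | ∃ χ ∈ collL F K, ∃ σ : K ≃ₐ[F] K, φ = lam σ * χ}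

end Model

section Permutations

/-- The permutation `f ↦ α (f^τ)^ε` of `F*`, where the sign `ε` is `1` or `-1`. -/
def xi {F : Type*} [Field F] (ε : ℤˣ) (α : Fˣ) (τ : F ≃+* F) : Equiv.Perm Fˣ where
  toFun f := α * (Units.map (τ : F →* F) f) ^ (ε : ℤ)
  invFun g := Units.map (τ.symm : F →* F) ((α⁻¹ * g) ^ (ε : ℤ))
  left_inv f := by
    ext
    obtain rfl | rfl := Int.units_eq_one_or ε <;> simp
  right_inv g := by
    ext
    obtain rfl | rfl := Int.units_eq_one_or ε <;> simp

theorem xi_apply {F : Type*} [Field F] (ε : ℤˣ) (α : Fˣ) (τ : F ≃+* F) (f : Fˣ) :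
    xi ε α τ f = α * (Units.map (τ : F →* F) f) ^ (ε : ℤ) := rfl

/-- The group `Ξ` of all permutations `f ↦ α f^{±τ}` of `F*`, with `α ∈ F*`, `τ ∈ Aut(F)`. -/
def Xi (F : Type*) [Field F] : Subgroup (Equiv.Perm Fˣ) where
  carrier := {π | ∃ (ε : ℤˣ) (α : Fˣ) (τ : F ≃+* F), π = xi ε α τ}
  mul_mem' := by
    rintro _ _ ⟨ε, α, τ, rfl⟩ ⟨δ, β, ρ, rfl⟩
    refine ⟨ε * δ, α * (Units.map (τ : F →* F) β) ^ (ε : ℤ), τ * ρ, ?_⟩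
    ext f
    obtain rfl | rfl := Int.units_eq_one_or ε <;> obtain rfl | rfl := Int.units_eq_one_or δ <;>
      simp [xi_apply, mul_assoc, mul_comm, mul_left_comm]
  one_mem' := ⟨1, 1, 1, by ext; simp [xi_apply]⟩
  inv_mem' := by
    rintro _ ⟨ε, α, τ, rfl⟩
    refine ⟨ε, Units.map (τ.symm : F →* F) ((α⁻¹) ^ (ε : ℤ)), τ.symm, ?_⟩
    rw [inv_eq_iff_mul_eq_one]
    ext f
    obtain rfl | rfl := Int.units_eq_one_or ε
    · simp [xi_apply]
    · simp [xi_apply, mul_left_comm (α : F)]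

variable {F K : Type*} [Field F] [Field K] [Finite K] [Algebra F K]

/-- The permutation `(ρ, f) ↦ (ρ^ε σ⁻¹, α (f^τ)^ε)` of `Aut(K/F) × F*`, where the sign `ε` is `1`
or `-1`. The group `Aut(K/F)` is abelian, so the order of the factors does not matter. -/
def upsilon (ε : ℤˣ) (α : Fˣ) (τ : F ≃+* F) (σ : K ≃ₐ[F] K) :
    Equiv.Perm ((K ≃ₐ[F] K) × Fˣ) where
  toFun x := (x.1 ^ (ε : ℤ) * σ⁻¹, xi ε α τ x.2)
  invFun y := ((y.1 * σ) ^ (ε : ℤ), (xi ε α τ).symm y.2)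
  left_inv x := by
    obtain rfl | rfl := Int.units_eq_one_or ε <;> simp
  right_inv y := by
    obtain rfl | rfl := Int.units_eq_one_or ε <;> simp

theorem gal_comm (σ τ : K ≃ₐ[F] K) : σ * τ = τ * σ :=
  (IsCyclic.commGroup (α := K ≃ₐ[F] K)).mul_comm σ τ

theorem gal_left_comm (σ τ ρ : K ≃ₐ[F] K) : σ * (τ * ρ) = τ * (σ * ρ) := by
  rw [← mul_assoc, gal_comm σ τ, mul_assoc]

variable (F K) in
/-- The group `Υ` of all permutations `(ρ, f) ↦ (ρ^{±1} σ⁻¹, α f^{±τ})` of `Aut(K/F) × F*`, with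
`α ∈ F*`, `τ ∈ Aut(F)`, `σ ∈ Aut(K/F)` and the same sign in both places. -/
def Upsilon : Subgroup (Equiv.Perm ((K ≃ₐ[F] K) × Fˣ)) where
  carrier := {π | ∃ (ε : ℤˣ) (α : Fˣ) (τ : F ≃+* F) (σ : K ≃ₐ[F] K), π = upsilon ε α τ σ}
  mul_mem' := by
    rintro _ _ ⟨ε, α, τ, σ, rfl⟩ ⟨δ, β, ρ, κ, rfl⟩
    refine ⟨ε * δ, α * (Units.map (τ : F →* F) β) ^ (ε : ℤ), τ * ρ, σ * κ ^ (ε : ℤ), ?_⟩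
    refine Equiv.ext fun x => Prod.ext ?_ ?_
    · obtain rfl | rfl := Int.units_eq_one_or ε <;> obtain rfl | rfl := Int.units_eq_one_or δ <;>
        simp [upsilon, mul_assoc, gal_comm, gal_left_comm]
    · ext
      obtain rfl | rfl := Int.units_eq_one_or ε <;> obtain rfl | rfl := Int.units_eq_one_or δ <;>
        simp [upsilon, xi_apply, mul_assoc, mul_comm, mul_left_comm]
  one_mem' := ⟨1, 1, 1, 1, by
    refine Equiv.ext fun x => Prod.ext ?_ ?_
    · simp [upsilon]
    · ext
      simp [upsilon, xi_apply]⟩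
  inv_mem' := by
    rintro _ ⟨ε, α, τ, σ, rfl⟩
    refine ⟨ε, Units.map (τ.symm : F →* F) ((α⁻¹) ^ (ε : ℤ)), τ.symm, σ⁻¹ ^ (ε : ℤ), ?_⟩
    rw [inv_eq_iff_mul_eq_one]
    refine Equiv.ext fun x => Prod.ext ?_ ?_
    · obtain rfl | rfl := Int.units_eq_one_or ε
      · simp [upsilon, mul_assoc]
      · simp [upsilon, gal_comm]
    · ext
      obtain rfl | rfl := Int.units_eq_one_or ε
      · simp [upsilon, xi_apply]
      · simp [upsilon, xi_apply, mul_left_comm (α : F)]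

end Permutations

/-- The permutation action of `G` on `X` (that is, the group of permutations of `X` induced by `G`)
is action-isomorphic, along the bijection `e : X ≃ Y`, to the permutation group `H` on `Y`: there
is a group isomorphism between the two that is compatible with `e`. -/
def IsActionIso (G : Type*) {X Y : Type*} [Group G] [MulAction G X]
    (H : Subgroup (Equiv.Perm Y)) (e : X ≃ Y) : Prop :=
  ∃ Φ : (MulAction.toPermHom G X).range ≃* H,
    ∀ (π : (MulAction.toPermHom G X).range) (x : X),
      e ((π : Equiv.Perm X) x) = (Φ π : Equiv.Perm Y) (e x)

end Andre

open Projectivization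
open scoped LinearAlgebra.Projectivization Pointwise

namespace Andre

/-! ### The fundamental theorem of projective geometry -/

section FundamentalTheorem

variable {F V : Type*} [Field F] [AddCommGroup V] [Module F V]

/-! Let `φ` stabilize a family `S` of norm surfaces lying between `linearSet` and `allSurfaces`. The
members of `S` cover exactly the points off the axes x = 0 and y = 0, so `φ` preserves the union of
the axes. Since dim(K ⊕ K) = 2(n+1) ≥ 4, the fundamental theorem (`Collineation.exists_semilinear`)
gives a semilinear `T` inducing `φ`. A group is not the union of two proper subgroups, so `T` maps
each axis into an axis; hence `T` is diagonal or antidiagonal (`diag_or_anti`), and the swap of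
coordinates reduces the second case to the first.

If T = (A, B) and `φ` sends J_1 to J^ρ_f, every e of norm one satisfies A(ex) = l ρ(Bx) for some l.
Comparison with e = 1 gives B(ex) = l' B(x). The k for which x ↦ B(kx) is a multiple of B form an
F-subspace containing all elements of norm one; there are (q^{n+1} - 1)/(q - 1) > q^n of these, so
the subspace is K (`eq_top_of_norm_one_mem`). Thus B is B(1) times a field automorphism
(`exists_eq_mul_ringEquiv`), and `φ` is some χ followed by λ_{ρ⁻¹}. For S = `linearSet` the image of
J_1 lies in `linearSet`, which forces ρ = 1.

Conversely, the images of the J^σ(k) under χ and λ are computed directly, using that Aut(K/F)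
commutes with Aut(K) and that the norm is equivariant. All of Ξ and Υ is reached because the norm is
surjective and automorphisms of F extend to K. -/

theorem eq_zero_of_smul_add_smul {x y : V} (hx : x ≠ 0) (hy : y ∉ Submodule.span F {x})
    {a b : F} (h : a • x + b • y = 0) : a = 0 ∧ b = 0 := by
  have hb : b = 0 := by
    by_contra hb
    refine hy (Submodule.mem_span_singleton.2 ⟨-(b⁻¹ * a), ?_⟩)
    have : b • y = -(a • x) := by rw [← add_eq_zero_iff_neg_eq.1 h]
    rw [neg_smul, mul_smul, ← smul_neg, ← this, inv_smul_smul₀ hb]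
  subst hb
  simpa [hx] using h

theorem eq_zero_of_smul_add_smul_add_smul {x y z : V} (hx : x ≠ 0)
    (hy : y ∉ Submodule.span F {x}) (hz : z ∉ Submodule.span F {x, y})
    {a b c : F} (h : a • x + b • y + c • z = 0) : a = 0 ∧ b = 0 ∧ c = 0 := by
  have hc : c = 0 := by
    by_contra hc
    refine hz (Submodule.mem_span_pair.2 ⟨-(c⁻¹ * a), -(c⁻¹ * b), ?_⟩)
    have : c • z = -(a • x + b • y) := by rw [← add_eq_zero_iff_neg_eq.1 h]
    rw [neg_smul, mul_smul, neg_smul, mul_smul, ← neg_add, ← smul_add, ← smul_neg, ← this,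
      inv_smul_smul₀ hc]
  subst hc
  rw [zero_smul, add_zero] at h
  exact ⟨(eq_zero_of_smul_add_smul hx hy h).1, (eq_zero_of_smul_add_smul hx hy h).2, rfl⟩

/-- `f` preserves and reflects membership in the span of two vectors. -/
structure PreservesSpans (F : Type*) {V : Type*} [Field F] [AddCommGroup V] [Module F V]
    (f : V → V) : Prop where
  eq_zero_iff : ∀ v, f v = 0 ↔ v = 0
  mem_span_iff : ∀ u v w, f u ∈ Submodule.span F {f v, f w} ↔ u ∈ Submodule.span F {v, w}

/-- `u'` is a nonzero multiple of `f u`. -/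
def Represents (F : Type*) {V : Type*} [Field F] [AddCommGroup V] [Module F V]
    (f : V → V) (u u' : V) : Prop := ∃ c : F, c ≠ 0 ∧ u' = c • f u

theorem represents_self (f : V → V) (u : V) : Represents F f u (f u) :=
  ⟨1, one_ne_zero, (one_smul _ _).symm⟩

section Represents

variable {f : V → V} {u v w u' v' w' : V}

theorem Represents.mem_span_iff (hf : PreservesSpans F f) (hu : Represents F f u u')
    (hv : Represents F f v v') (hw : Represents F f w w') :
    u' ∈ Submodule.span F {v', w'} ↔ u ∈ Submodule.span F {v, w} := by
  obtain ⟨a, ha, rfl⟩ := hu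
  obtain ⟨b, hb, rfl⟩ := hv
  obtain ⟨c, hc, rfl⟩ := hw
  rw [Submodule.smul_mem_iff _ ha, ← hf.mem_span_iff u v w, Submodule.span_insert, Submodule.span_insert,
    Submodule.span_singleton_smul_eq hb.isUnit, Submodule.span_singleton_smul_eq hc.isUnit]

theorem Represents.mem_span_singleton_iff (hf : PreservesSpans F f) (hu : Represents F f u u')
    (hv : Represents F f v v') : u' ∈ Submodule.span F {v'} ↔ u ∈ Submodule.span F {v} := by
  simpa using hu.mem_span_iff hf hv hv

theorem Represents.eq_zero_iff (hf : PreservesSpans F f) (hu : Represents F f u u') :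
    u' = 0 ↔ u = 0 := by
  obtain ⟨a, ha, rfl⟩ := hu
  rw [smul_eq_zero_iff_right ha, hf.eq_zero_iff]

theorem Represents.smul_smul (hf : PreservesSpans F f) (hu : Represents F f u u') {a b : F}
    (ha : a ≠ 0) (hb : b ≠ 0) : Represents F f (a • u) (b • u') := by
  obtain ⟨c, hc, rfl⟩ := hu
  by_cases hu : u = 0
  · subst hu
    exact ⟨1, one_ne_zero, by simp [(hf.eq_zero_iff 0).2 rfl]⟩
  have h := (hf.mem_span_iff (a • u) u u).2 (by simp [Submodule.mem_span_singleton])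
  rw [Set.pair_eq_singleton, Submodule.mem_span_singleton] at h
  obtain ⟨d, hd⟩ := h
  have hd0 : d ≠ 0 := by
    rintro rfl
    rw [zero_smul, eq_comm, hf.eq_zero_iff, smul_eq_zero] at hd
    tauto
  refine ⟨b * c * d⁻¹, by simp [*], ?_⟩
  rw [← hd, smul_smul, smul_smul, inv_mul_cancel_right₀ hd0]

end Represents

section Lift

variable {f : V → V} {e : V} {l : V →ₗ[F] F}

/-- The point of e + x lies on the line joining those of e and x but equals neither, so f(e + x) is
a combination of f(e) and f(x) with nonzero coefficients; rescaling makes the first one 1. This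
defines the lift `h` on the affine chart e + ker l. -/
theorem exists_represents_add (hf : PreservesSpans F f) (hl : l e = 1) {x : V} (hx : l x = 0) :
    ∃ y, Represents F f x y ∧ Represents F f (e + x) (f e + y) := by
  by_cases hx0 : x = 0
  · subst hx0
    refine ⟨0, ⟨1, one_ne_zero, by simp [(hf.eq_zero_iff 0).2 rfl]⟩, ?_⟩
    simpa using represents_self f e
  have h := (hf.mem_span_iff (e + x) e x).2
    (Submodule.mem_span_pair.2 ⟨1, 1, by simp⟩)
  obtain ⟨a, b, hab⟩ := Submodule.mem_span_pair.1 h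
  have ha : a ≠ 0 := by
    rintro rfl
    have h' := (hf.mem_span_iff (e + x) x x).1 (by
      rw [← hab]; simp [Submodule.mem_span_singleton])
    rw [Set.pair_eq_singleton, Submodule.mem_span_singleton] at h'
    obtain ⟨c, hc⟩ := h'
    simpa [hl, hx] using congrArg l hc
  have hb : b ≠ 0 := by
    rintro rfl
    have h' := (hf.mem_span_iff (e + x) e e).1 (by
      rw [← hab]; simp [Submodule.mem_span_singleton])
    rw [Set.pair_eq_singleton, Submodule.mem_span_singleton] at h'
    obtain ⟨c, hc⟩ := h'
    have hc1 : c = 1 := by simpa [hl, hx] using congrArg l hc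
    subst hc1
    simp at hc
    exact hx0 hc
  refine ⟨(a⁻¹ * b) • f x, ⟨a⁻¹ * b, by simp [*], rfl⟩, a⁻¹, by simp [*], ?_⟩
  rw [← hab, smul_add, smul_smul, smul_smul, inv_mul_cancel₀ ha, one_smul]

variable {h : V → V}

/-- Parallelogram construction: e + x + y is on the line through e + x and y and on the line through
e + y and x, while x + y is on the line through x and y. Comparing coefficients in the independent
vectors f(e), h(x), h(y) makes both coefficients of h(x + y) equal to 1. -/
theorem map_add_of_notMem_span (hf : PreservesSpans F f) (hl : l e = 1)
    (h₁ : ∀ x, l x = 0 → Represents F f x (h x))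
    (h₂ : ∀ x, l x = 0 → Represents F f (e + x) (f e + h x))
    {x y : V} (hx : l x = 0) (hy : l y = 0) (hx0 : x ≠ 0) (hxy : y ∉ Submodule.span F {x}) :
    h (x + y) = h x + h y := by
  have hxy' : l (x + y) = 0 := by simp [hx, hy]
  have he : Represents F f e (f e) := represents_self f e
  have he0 : e ≠ 0 := by rintro rfl; simp at hl
  have i1 : f e ≠ 0 := by rwa [Ne, hf.eq_zero_iff]
  have i2 : h x ∉ Submodule.span F {f e} := by
    rw [(h₁ x hx).mem_span_singleton_iff hf he, Submodule.mem_span_singleton]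
    rintro ⟨c, rfl⟩
    have : c = 0 := by simpa [hl] using hx
    exact hx0 (by simp [this])
  have i3 : h y ∉ Submodule.span F {f e, h x} := by
    rw [(h₁ y hy).mem_span_iff hf he (h₁ x hx), Submodule.mem_span_pair]
    rintro ⟨a, b, rfl⟩
    have : a = 0 := by simpa [hl, hx] using hy
    exact hxy (Submodule.mem_span_singleton.2 ⟨b, by simp [this]⟩)
  have hs := h₂ _ hxy'
  obtain ⟨p, q, hpq⟩ := Submodule.mem_span_pair.1 <| (hs.mem_span_iff hf (h₂ x hx) (h₁ y hy)).2
    (Submodule.mem_span_pair.2 ⟨1, 1, by simp [add_assoc]⟩)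
  obtain ⟨r, s, hrs⟩ := Submodule.mem_span_pair.1 <| (hs.mem_span_iff hf (h₂ y hy) (h₁ x hx)).2
    (Submodule.mem_span_pair.2 ⟨1, 1, by simp [add_assoc, add_comm y x]⟩)
  obtain ⟨a, b, hab⟩ := Submodule.mem_span_pair.1 <|
    ((h₁ _ hxy').mem_span_iff hf (h₁ x hx) (h₁ y hy)).2
    (Submodule.mem_span_pair.2 ⟨1, 1, by simp⟩)
  rw [← hab, ← sub_eq_zero] at hpq hrs
  rw [← hab]
  obtain ⟨j1, j2, j3⟩ := eq_zero_of_smul_add_smul_add_smul (a := p - 1) (b := p - a) (c := q - b)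
    i1 i2 i3 (by rw [← hpq]; module)
  obtain ⟨k1, k2, k3⟩ := eq_zero_of_smul_add_smul_add_smul (a := r - 1) (b := s - a) (c := r - b)
    i1 i2 i3 (by rw [← hrs]; module)
  have ha : a = 1 := by linear_combination j1 - j2
  have hb : b = 1 := by linear_combination k1 - k3
  rw [ha, hb, one_smul, one_smul]

theorem map_add_of_ker (hf : PreservesSpans F f) (hl : l e = 1)
    (hdim : ∀ x y : V, ∃ z, l z = 0 ∧ z ∉ Submodule.span F {x, y})
    (h₁ : ∀ x, l x = 0 → Represents F f x (h x))
    (h₂ : ∀ x, l x = 0 → Represents F f (e + x) (f e + h x))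
    {x y : V} (hx : l x = 0) (hy : l y = 0) : h (x + y) = h x + h y := by
  have h0 : h 0 = 0 := ((h₁ 0 (map_zero l)).eq_zero_iff hf).2 rfl
  -- For dependent x and y, h(x + y + z) is expanded in two ways with an auxiliary z outside their
  -- span.
  obtain ⟨z, hz, hzxy⟩ := hdim x y
  rw [Submodule.mem_span_pair] at hzxy
  by_cases hx0 : x = 0
  · simp [hx0, h0]
  by_cases hy0 : y = 0
  · simp [hy0, h0]
  have e1 : h (y + z) = h y + h z := by
    refine map_add_of_notMem_span hf hl h₁ h₂ hy hz hy0 ?_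
    rw [Submodule.mem_span_singleton]
    rintro ⟨c, rfl⟩
    exact hzxy ⟨0, c, by simp⟩
  have e2 : h (x + (y + z)) = h x + h (y + z) := by
    refine map_add_of_notMem_span hf hl h₁ h₂ hx (by simp [hy, hz]) hx0 ?_
    rw [Submodule.mem_span_singleton]
    rintro ⟨c, hc⟩
    exact hzxy ⟨c, -1, by rw [hc]; simp⟩
  have e3 : h ((x + y) + z) = h (x + y) + h z := by
    by_cases hxy : x + y = 0
    · simp [hxy, h0]
    refine map_add_of_notMem_span hf hl h₁ h₂ (by simp [hx, hy]) hz hxy ?_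
    rw [Submodule.mem_span_singleton]
    rintro ⟨c, rfl⟩
    exact hzxy ⟨c, c, by simp⟩
  rw [add_assoc, e2, e1, ← add_assoc] at e3
  exact (add_right_cancel e3).symm

/-- Each h(ax) is a multiple of h(x). For independent x and y, additivity at x + y forces equal
factors; dependent vectors are compared through a third one. -/
theorem exists_map_smul_of_ker (hf : PreservesSpans F f) (hl : l e = 1)
    (hdim : ∀ x y : V, ∃ z, l z = 0 ∧ z ∉ Submodule.span F {x, y})
    (h₁ : ∀ x, l x = 0 → Represents F f x (h x))
    (h₂ : ∀ x, l x = 0 → Represents F f (e + x) (f e + h x)) (a : F) :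
    ∃ s : F, ∀ x, l x = 0 → h (a • x) = s • h x := by
  have h0 : h 0 = 0 := ((h₁ 0 (map_zero l)).eq_zero_iff hf).2 rfl
  have mult : ∀ x, l x = 0 → ∃ s : F, s • h x = h (a • x) := by
    intro x hx
    rw [← Submodule.mem_span_singleton,
      (h₁ (a • x) (by simp [hx])).mem_span_singleton_iff hf (h₁ x hx)]
    simp [Submodule.mem_span_singleton]
  have key : ∀ x y, l x = 0 → l y = 0 → x ≠ 0 → y ∉ Submodule.span F {x} → ∀ s : F,
      h (a • x) = s • h x → h (a • y) = s • h y := by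
    intro x y hx hy hx0 hxy s hs
    obtain ⟨t, ht⟩ := mult y hy
    obtain ⟨r, hr⟩ := mult (x + y) (by simp [hx, hy])
    rw [map_add_of_ker hf hl hdim h₁ h₂ hx hy, smul_add a x y,
      map_add_of_ker hf hl hdim h₁ h₂ (by simp [hx]) (by simp [hy]), hs, ← ht] at hr
    obtain ⟨k1, k2⟩ := eq_zero_of_smul_add_smul (x := h x) (y := h y) (a := r - s) (b := r - t)
      (by rwa [Ne, (h₁ x hx).eq_zero_iff hf])
      (by rwa [(h₁ y hy).mem_span_singleton_iff hf (h₁ x hx)])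
      (by rw [← sub_eq_zero.2 hr]; module)
    rw [← ht]
    congr 1
    linear_combination k1 - k2
  obtain ⟨x, hx, hx0⟩ := hdim 0 0
  have hx0 : x ≠ 0 := by
    rintro rfl
    simp at hx0
  obtain ⟨s, hs⟩ := mult x hx
  refine ⟨s, fun y hy => ?_⟩
  by_cases hy0 : y = 0
  · simp [hy0, h0]
  obtain ⟨z, hz, hzxy⟩ := hdim x y
  rw [Submodule.mem_span_pair] at hzxy
  have hz0 : z ≠ 0 := by
    rintro rfl
    exact hzxy ⟨0, 0, by simp⟩
  refine key z y hz hy hz0 ?_ s (key x z hx hz hx0 ?_ s hs.symm)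
  · rw [Submodule.mem_span_singleton]
    rintro ⟨c, rfl⟩
    have hc : c ≠ 0 := by
      rintro rfl
      simp at hy0
    exact hzxy ⟨0, c⁻¹, by simp [hc]⟩
  · rw [Submodule.mem_span_singleton]
    rintro ⟨c, rfl⟩
    exact hzxy ⟨c, 0, by simp⟩

end Lift

/-- The algebraic core of the fundamental theorem of projective geometry: up to scalars, a map
preserving and reflecting membership in spans of two vectors is semilinear. -/
theorem PreservesSpans.exists_semilinear {f : V → V} (hf : PreservesSpans F f)
    (hdim : 4 ≤ Module.finrank F V) :
    ∃ (σ : F →+* F) (T : V →ₛₗ[σ] V), ∀ v, Represents F f v (T v) := by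
  have : FiniteDimensional F V := Module.finite_of_finrank_pos (by omega)
  have : Nontrivial V := Module.nontrivial_of_finrank_pos (R := F) (by omega)
  obtain ⟨e, he⟩ := exists_ne (0 : V)
  obtain ⟨l, hl⟩ : ∃ l : V →ₗ[F] F, l e = 1 := by
    obtain ⟨g, hg⟩ : ∃ g : Module.Dual F V, g e ≠ 0 := by
      by_contra! h
      exact he ((Module.forall_dual_apply_eq_zero_iff F e).1 h)
    exact ⟨(g e)⁻¹ • g, by simp [hg]⟩
  -- The kernel has dimension at least 3, so two vectors cannot span it. This is where dimension 4
  -- enters.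
  have hker : ∀ x y : V, ∃ z, l z = 0 ∧ z ∉ Submodule.span F {x, y} := by
    intro x y
    by_contra! hcon
    have hle : LinearMap.ker l ≤ Submodule.span F {x, y} := fun z hz => hcon z hz
    have h1 := Submodule.finrank_mono hle
    have h2 : Module.finrank F (Submodule.span F {x, y}) ≤ 2 := by
      classical
      refine (finrank_span_le_card _).trans ?_
      simpa using Finset.card_le_two
    have h3 := LinearMap.finrank_range_add_finrank_ker l
    have h4 := Submodule.finrank_le (LinearMap.range l)
    rw [Module.finrank_self] at h4
    omega
  have hex : ∀ x, ∃ y, l x = 0 → Represents F f x y ∧ Represents F f (e + x) (f e + y) := by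
    intro x
    by_cases hx : l x = 0
    · obtain ⟨y, hy⟩ := exists_represents_add hf hl hx
      exact ⟨y, fun _ => hy⟩
    · exact ⟨0, fun h => absurd h hx⟩
  choose h hh using hex
  have h₁ := fun x hx => (hh x hx).1
  have h₂ := fun x hx => (hh x hx).2
  have hadd := @map_add_of_ker _ _ _ _ _ f e l h hf hl hker h₁ h₂
  choose s hs using exists_map_smul_of_ker hf hl hker h₁ h₂
  obtain ⟨x₀, hx₀, hx₀'⟩ := hker 0 0
  have hx₀0 : h x₀ ≠ 0 := by
    rw [Ne, (h₁ x₀ hx₀).eq_zero_iff hf]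
    rintro rfl
    simp at hx₀'
  have inj : ∀ a b : F, a • h x₀ = b • h x₀ → a = b := fun a b => (smul_left_injective F hx₀0 ·)
  let σ : F →+* F :=
    { toFun := s
      map_one' := inj _ _ (by rw [← hs 1 x₀ hx₀, one_smul, one_smul])
      map_zero' := inj _ _ (by
        rw [← hs 0 x₀ hx₀, zero_smul, zero_smul, (h₁ 0 (map_zero l)).eq_zero_iff hf])
      map_mul' := fun a b => inj _ _ (by
        rw [← hs _ x₀ hx₀, mul_smul, mul_smul, hs a _ (by simp [hx₀]), hs b _ hx₀])
      map_add' := fun a b => inj _ _ (by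
        rw [← hs _ x₀ hx₀, add_smul, add_smul, hadd (by simp [hx₀]) (by simp [hx₀]),
          hs a _ hx₀, hs b _ hx₀]) }
  have hpr : ∀ v, l (v - l v • e) = 0 := fun v => by simp [hl]
  refine ⟨σ,
    { toFun := fun v => σ (l v) • f e + h (v - l v • e)
      map_add' := fun v w => by
        have : v + w - l (v + w) • e = (v - l v • e) + (w - l w • e) := by
          rw [map_add, add_smul]; abel
        rw [this, hadd (hpr v) (hpr w), map_add, map_add, add_smul]
        abel
      map_smul' := fun a v => by
        have : a • v - l (a • v) • e = a • (v - l v • e) := by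
          rw [map_smul, smul_sub, smul_eq_mul, mul_smul]
        rw [this, hs a _ (hpr v), map_smul, smul_eq_mul, map_mul, smul_add, mul_smul]
        rfl }, fun v => ?_⟩
  change Represents F f v (σ (l v) • f e + h (v - l v • e))
  by_cases hv : l v = 0
  · simpa [hv] using h₁ v hv
  · have hσ : σ (l v) ≠ 0 := by simpa using hv
    -- Off the kernel, v is l(v) times a vector of the chart e + ker l.
    have := (h₂ ((l v)⁻¹ • (v - l v • e)) (by simp [hl])).smul_smul hf hv hσ
    convert this using 1
    · rw [smul_add, smul_inv_smul₀ hv]; abel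
    · rw [smul_add, show σ (l v) = s (l v) from rfl, ← hs _ _ (by simp [hl]),
        smul_inv_smul₀ hv]

theorem isCollinear_triple_iff {u v w : V} (hu : u ≠ 0) (hv : v ≠ 0) (hw : w ≠ 0)
    (hvw : mk F v hv ≠ mk F w hw) :
    IsCollinear {mk F u hu, mk F v hv, mk F w hw} ↔ u ∈ Submodule.span F {v, w} := by
  rw [← independent_pair_iff_ne, independent_mk_iff_LinearIndependent] at hvw
  have hrank : Module.finrank F (Submodule.span F {v, w}) = 2 := by
    rw [← Matrix.range_cons_cons_empty v w ![]]
    simp [finrank_span_eq_card hvw]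
  constructor
  · rintro ⟨M, hM, hM2, hS⟩
    have hle : Submodule.span F {v, w} ≤ M.submodule := by
      rw [Submodule.span_le]
      rintro x (rfl | rfl)
      · exact (Subspace.mem_submodule_iff _ hv).2 (hS (by simp))
      · exact (Subspace.mem_submodule_iff _ hw).2 (hS (by simp))
    rw [Submodule.eq_of_le_of_finrank_le hle (by omega)]
    exact (Subspace.mem_submodule_iff _ hu).2 (hS (by simp))
  · intro h
    refine ⟨(Submodule.span F {v, w}).projectivization, ?_, ?_, ?_⟩
    · rw [Subspace.submodule.apply_symm_apply]
      exact Module.Finite.span_of_finite _ (Set.toFinite _)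
    · rw [Subspace.submodule.apply_symm_apply, hrank]
    · rintro p (rfl | rfl | rfl)
      · exact h
      · exact Submodule.subset_span (by simp)
      · exact Submodule.subset_span (by simp)

/-- The fundamental theorem of projective geometry: a collineation of a projective space of
dimension at least three is induced by a semilinear map. -/
theorem Collineation.exists_semilinear (φ : Collineation F V) (hdim : 4 ≤ Module.finrank F V) :
    ∃ (σ : F →+* F) (T : V →ₛₗ[σ] V), ∀ (v : V) (hv : v ≠ 0), ∃ hT : T v ≠ 0,
      (φ : Equiv.Perm (ℙ F V)) (mk F v hv) = mk F (T v) hT := by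
  classical
  -- Arbitrary representatives of the image points, with value 0 at 0 so that `PreservesSpans` also
  -- holds for degenerate spans.
  let f : V → V := fun v => if hv : v = 0 then 0 else
    ((φ : Equiv.Perm (ℙ F V)) (mk F v hv)).rep
  have f0 : f 0 = 0 := by simp [f]
  have fne : ∀ v, v ≠ 0 → f v ≠ 0 := fun v hv => by
    simp only [f, hv, dif_neg, not_false_eq_true]
    exact rep_nonzero _
  have fmk : ∀ v (hv : v ≠ 0), (φ : Equiv.Perm (ℙ F V)) (mk F v hv) = mk F (f v) (fne v hv) :=
    fun v hv => by simp [f, hv]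
  have mem_single : ∀ u v : V, f u ∈ Submodule.span F {f v} ↔ u ∈ Submodule.span F {v} := by
    intro u v
    by_cases hu : u = 0
    · simp [hu, f0]
    by_cases hv : v = 0
    · simp [hv, f0, hu, fne u hu]
    rw [Submodule.mem_span_singleton, Submodule.mem_span_singleton,
      ← mk_eq_mk_iff' F _ _ hu hv, ← mk_eq_mk_iff' F _ _ (fne u hu) (fne v hv), ← fmk, ← fmk,
      EmbeddingLike.apply_eq_iff_eq]
  have hf : PreservesSpans F f := by
    refine ⟨fun v => ⟨fun h => by_contra fun hv => fne v hv h, fun h => h ▸ f0⟩, fun u v w => ?_⟩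
    by_cases hu : u = 0
    · simp [hu, f0]
    by_cases hv : v = 0
    · simpa [hv, f0, Submodule.span_insert] using mem_single u w
    by_cases hw : w = 0
    · simpa [hw, f0, Submodule.span_insert] using mem_single u v
    by_cases hvw : mk F v hv = mk F w hw
    · have hvw' : mk F (f v) (fne v hv) = mk F (f w) (fne w hw) := by rw [← fmk v hv, ← fmk w hw, hvw]
      obtain ⟨a, ha⟩ := (mk_eq_mk_iff' ..).1 hvw
      obtain ⟨b, hb⟩ := (mk_eq_mk_iff' ..).1 hvw'
      rw [Submodule.span_insert_eq_span (Submodule.mem_span_singleton.2 ⟨a, ha⟩),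
        Submodule.span_insert_eq_span (Submodule.mem_span_singleton.2 ⟨b, hb⟩)]
      exact mem_single u w
    · rw [← isCollinear_triple_iff hu hv hw hvw,
        ← isCollinear_triple_iff (fne u hu) (fne v hv) (fne w hw)
          (by rwa [← fmk v hv, ← fmk w hw, Ne, EmbeddingLike.apply_eq_iff_eq]),
        ← φ.2 {mk F u hu, mk F v hv, mk F w hw}]
      simp only [Set.image_insert_eq, Set.image_singleton, fmk]
  obtain ⟨σ, T, hT⟩ := hf.exists_semilinear hdim
  refine ⟨σ, T, fun v hv => ?_⟩
  have hTv : T v ≠ 0 := by rwa [Ne, (hT v).eq_zero_iff hf]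
  refine ⟨hTv, ?_⟩
  obtain ⟨c, hc, h⟩ := hT v
  rw [fmk v hv, eq_comm, mk_eq_mk_iff']
  exact ⟨c, h.symm⟩

end FundamentalTheorem

/-! ### Automorphisms and norms of finite fields -/

section FiniteFields

variable {F K : Type*} [Field F] [Field K] [Finite K] [Algebra F K]

theorem exists_algEquiv_eq_pow (σ : K ≃ₐ[F] K) : ∃ m : ℕ, ∀ x, σ x = x ^ m := by
  have : Finite F := Finite.of_injective _ (algebraMap F K).injective
  let _ := Fintype.ofFinite F
  obtain ⟨m, rfl⟩ := (FiniteField.bijective_frobeniusAlgEquivOfAlgebraic_pow F K).2 σ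
  refine ⟨Fintype.card F ^ m.1, fun x => ?_⟩
  simp only [AlgEquiv.coe_pow, FiniteField.coe_frobeniusAlgEquivOfAlgebraic, pow_iterate]

/-- An element of Aut(K/F) is a power map, and ring automorphisms respect powers. -/
theorem algEquiv_ringEquiv_comm (σ : K ≃ₐ[F] K) (μ : K ≃+* K) (x : K) : σ (μ x) = μ (σ x) := by
  obtain ⟨m, hm⟩ := exists_algEquiv_eq_pow σ
  rw [hm, hm, map_pow]

theorem exists_restrict_equiv (F : Type*) [Field F] [Algebra F K] (μ : K ≃+* K) :
    ∃ τ : F ≃+* F, ∀ f, algebraMap F K (τ f) = μ (algebraMap F K f) := by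
  have : Finite F := Finite.of_injective _ (algebraMap F K).injective
  exact ⟨RingEquiv.ofBijective (restrictF F μ)
    (Finite.injective_iff_bijective.1 (restrictF F μ).injective), algebraMap_restrictF μ⟩

/-- Over the prime field, τ is a power of Frobenius; the same power of Frobenius on K extends it. -/
theorem exists_extend_equiv (K : Type*) [Field K] [Finite K] [Algebra F K] (τ : F ≃+* F) :
    ∃ μ : K ≃+* K, ∀ f, algebraMap F K (τ f) = μ (algebraMap F K f) := by
  have : Finite F := Finite.of_injective _ (algebraMap F K).injective
  obtain ⟨p, hp⟩ := CharP.exists K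
  have hprime : Fact p.Prime := ⟨CharP.char_is_prime K p⟩
  have : CharP F p := (algebraMap F K).charP (algebraMap F K).injective p
  let _ : Algebra (ZMod p) F := ZMod.algebra F p
  let τ' : F ≃ₐ[ZMod p] F := AlgEquiv.ofRingEquiv (f := τ) fun x => by
    simpa using RingHom.congr_fun
      (Subsingleton.elim ((τ : F →+* F).comp (algebraMap (ZMod p) F)) (algebraMap (ZMod p) F)) x
  obtain ⟨m, hm⟩ := (FiniteField.bijective_frobeniusAlgEquivOfAlgebraic_pow (ZMod p) F).2 τ'
  have hτ : ∀ f, τ f = f ^ p ^ m.1 := by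
    intro f
    change τ' f = _
    rw [← hm]
    simp only [AlgEquiv.coe_pow, FiniteField.coe_frobeniusAlgEquivOfAlgebraic, pow_iterate,
      ZMod.card]
  refine ⟨RingEquiv.ofBijective (iterateFrobenius K p m.1)
    (Finite.injective_iff_bijective.1 (iterateFrobenius K p m.1).injective), fun f => ?_⟩
  simp [hτ, iterateFrobenius_def]

theorem norm_ringEquiv {μ : K ≃+* K} {τ : F ≃+* F}
    (hτ : ∀ f, algebraMap F K (τ f) = μ (algebraMap F K f)) (k : K) :
    Algebra.norm F (μ k) = τ (Algebra.norm F k) := by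
  apply (algebraMap F K).injective
  rw [hτ, FiniteField.algebraMap_norm_eq_pow, FiniteField.algebraMap_norm_eq_pow, map_pow]

theorem norm_algEquiv (σ : K ≃ₐ[F] K) (k : K) : Algebra.norm F (σ k) = Algebra.norm F k :=
  norm_ringEquiv (μ := σ.toRingEquiv) (τ := RingEquiv.refl F) (by simp) k

theorem exists_norm_eq (K : Type*) [Field K] [Finite K] [Algebra F K] (α : Fˣ) :
    ∃ a : K, Algebra.norm F a = α ∧ a ≠ 0 := by
  have : Finite F := Finite.of_injective _ (algebraMap F K).injective
  obtain ⟨a, ha⟩ := FiniteField.norm_surjective F K (α : F)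
  refine ⟨a, ha, ?_⟩
  rintro rfl
  rw [Algebra.norm_zero] at ha
  exact α.ne_zero ha.symm

/-- The elements of norm one of a proper extension of finite fields span it as a vector space. -/
theorem eq_top_of_norm_one_mem (hdim : 2 ≤ Module.finrank F K) (S : Submodule F K)
    (hS : ∀ e : K, Algebra.norm F e = 1 → e ∈ S) : S = ⊤ := by
  have : Finite F := Finite.of_injective _ (algebraMap F K).injective
  by_contra hne
  have hlt : Module.finrank F S < Module.finrank F K := Submodule.finrank_lt hne
  set E := (Units.map (Algebra.norm F (S := K))).ker
  have hE : Nat.card E ≤ Nat.card S := by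
    refine Nat.card_le_card_of_injective (fun x : E => (⟨(x : Kˣ), hS _ ?_⟩ : S)) ?_
    · exact congrArg Units.val (MonoidHom.mem_ker.1 x.2)
    · intro x y h
      exact Subtype.ext (Units.ext (congrArg Subtype.val h))
  have hcard : Nat.card E * (Nat.card F - 1) = Nat.card K - 1 := by
    rw [← Nat.card_units, ← Nat.card_units, ← Subgroup.card_mul_index E, Subgroup.index_ker,
      MonoidHom.range_eq_top.2 (FiniteField.unitsMap_norm_surjective F K), Subgroup.card_top]
  have hq : 2 ≤ Nat.card F := Finite.one_lt_card
  rw [Module.natCard_eq_pow_finrank (K := F) (V := S)] at hE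
  rw [Module.natCard_eq_pow_finrank (K := F) (V := K)] at hcard
  set q := Nat.card F
  obtain ⟨n, hn⟩ : ∃ n, Module.finrank F K = n + 1 := ⟨Module.finrank F K - 1, by omega⟩
  have h1 : q ^ Module.finrank F S ≤ q ^ n := Nat.pow_le_pow_right (by omega) (by omega)
  have h2 : q ≤ q ^ n := Nat.le_self_pow (by omega) q
  -- If S were proper, then |E| ≤ q^n and q^{n+1} - 1 = |E|(q - 1) ≤ q^{n+1} - q^n, impossible as
  -- q^n ≥ q ≥ 2. The bound `h4` controls the truncated subtraction.
  have h3 := Nat.mul_le_mul_right (q - 1) (hE.trans h1)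
  rw [hcard, hn, pow_succ, Nat.mul_sub, mul_one] at h3
  have h4 : q ^ n * 2 ≤ q ^ n * q := Nat.mul_le_mul_left _ hq
  omega

end FiniteFields

/-! ### Collineations given by maps, and their action on norm surfaces -/

section Induces

variable {F V : Type*} [Field F] [AddCommGroup V] [Module F V]

/-- The collineation `φ` is given by `[v] ↦ [T v]`. -/
def Induces (φ : Collineation F V) (T : V → V) : Prop :=
  ∀ (v : V) (hv : v ≠ 0), ∃ hw : T v ≠ 0, φ • mk F v hv = mk F (T v) hw

theorem Induces.mul {φ ψ : Collineation F V} {T S : V → V} (hφ : Induces φ T)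
    (hψ : Induces ψ S) : Induces (φ * ψ) (T ∘ S) := by
  intro v hv
  obtain ⟨h1, e1⟩ := hψ v hv
  obtain ⟨h2, e2⟩ := hφ (S v) h1
  exact ⟨h2, by rw [mul_smul, e1, e2]; rfl⟩

theorem Induces.eq {φ ψ : Collineation F V} {T : V → V} (hφ : Induces φ T)
    (hψ : Induces ψ T) : φ = ψ := by
  apply Subtype.ext
  ext p
  induction p using Projectivization.ind with | h v hv =>
  obtain ⟨h1, e1⟩ := hφ v hv
  obtain ⟨h2, e2⟩ := hψ v hv
  exact e1.trans e2.symm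

end Induces

section Action

variable {F K : Type*} [Field F] [Field K] [Algebra F K]

theorem induces_lam [Finite K] (s : K ≃ₐ[F] K) : Induces (lam s) fun v => (v.1, s v.2) :=
  fun v hv => ⟨fun h => hv (by simpa [Prod.ext_iff] using h), rfl⟩

theorem induces_chi [Finite K] {a b c d : K} {μ : K ≃+* K} (h : a * d - b * c ≠ 0) :
    Induces (chi F a b c d μ h) (chiFun a b c d μ) := by
  refine fun v hv => ⟨fun h0 => hv ((chiFun_bijective a b c d μ h).1 ?_), rfl⟩
  rw [h0]
  simp [chiFun, Prod.ext_iff]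

theorem mk_mem_J {σ : K ≃ₐ[F] K} {k : K} {v : K × K} {hv : v ≠ 0} :
    mk F v hv ∈ J σ k ↔ v.1 = k * σ v.2 := by
  constructor
  · rintro ⟨x, hx, h⟩
    obtain ⟨c, rfl⟩ := (mk_eq_mk_iff' ..).1 h
    simp
  · intro h
    have hv' : v = (k * σ v.2, v.2) := Prod.ext h rfl
    exact ⟨v.2, hv' ▸ hv, by congr 1⟩

/-- The value at x = 1 recovers k, since automorphisms fix 1; cancelling k then recovers σ. -/
theorem J_injective {σ ρ : K ≃ₐ[F] K} {k l : K} (hk : k ≠ 0) (h : J σ k = J ρ l) :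
    σ = ρ ∧ k = l := by
  have key : ∀ x, k * σ x = l * ρ x := by
    intro x
    by_cases hx : x = 0
    · simp [hx]
    have hv : (k * σ x, x) ≠ (0 : K × K) := by simp [hx]
    have : mk F _ hv ∈ J ρ l := h ▸ mk_mem_J.2 rfl
    exact mk_mem_J.1 this
  have hkl : k = l := by simpa using key 1
  subst hkl
  exact ⟨AlgEquiv.ext fun x => mul_left_cancel₀ hk (key x), rfl⟩

theorem Induces.smul_J_eq {φ : Collineation F (K × K)} {T : K × K → K × K} (hT : Induces φ T)
    {σ ρ : K ≃ₐ[F] K} {k l : K} (h : ∀ v, (T v).1 = l * ρ (T v).2 ↔ v.1 = k * σ v.2) :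
    φ • J σ k = J ρ l := by
  ext p
  obtain ⟨p, rfl⟩ := MulAction.surjective φ p
  rw [Set.smul_mem_smul_set_iff]
  induction p using Projectivization.ind with | h v hv =>
  obtain ⟨hw, e⟩ := hT v hv
  rw [mk_mem_J, ← h]
  change _ ↔ φ • mk F v hv ∈ _
  rw [e, mk_mem_J]

/-- Here `g` is the action on the parameter k. Only nonzero parameters matter, since 0 has norm 0,
which is not a unit. -/
theorem smul_normSurface_eq {φ : Collineation F (K × K)} {σ ρ : K ≃ₐ[F] K} {f f' : Fˣ}
    (g : K → K) (hg : ∀ l, l ≠ 0 → ∃ k, g k = l)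
    (hN : ∀ k, Algebra.norm F (g k) = f' ↔ Algebra.norm F k = f)
    (hJ : ∀ k, k ≠ 0 → φ • J σ k = J ρ (g k)) [Finite K] :
    φ • normSurface σ f = normSurface ρ f' := by
  have ne : ∀ {k : K} {f : Fˣ}, Algebra.norm F k = f → k ≠ 0 := by
    rintro k f h rfl
    rw [Algebra.norm_zero] at h
    exact f.ne_zero h.symm
  ext U
  constructor
  · rintro ⟨_, ⟨k, hk, rfl⟩, rfl⟩
    exact ⟨g k, (hN k).2 hk, hJ k (ne hk)⟩
  · rintro ⟨l, hl, rfl⟩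
    obtain ⟨k, rfl⟩ := hg l (ne hl)
    have hk := (hN k).1 hl
    exact ⟨J σ k, ⟨k, hk, rfl⟩, hJ k (ne hk)⟩

theorem normSurface_injective [Finite K] {σ ρ : K ≃ₐ[F] K} {f g : Fˣ}
    (h : normSurface σ f = normSurface ρ g) : σ = ρ ∧ f = g := by
  obtain ⟨k, hk, hk0⟩ := exists_norm_eq K f
  obtain ⟨l, hl, hkl⟩ : J σ k ∈ normSurface ρ g := h ▸ ⟨k, hk, rfl⟩
  obtain ⟨h1, rfl⟩ := J_injective hk0 hkl
  exact ⟨h1, Units.ext (hk.symm.trans hl)⟩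

variable [Finite K]

theorem lam_smul_normSurface (s σ : K ≃ₐ[F] K) (f : Fˣ) :
    lam s • normSurface σ f = normSurface (σ * s⁻¹) f := by
  refine smul_normSurface_eq id (fun l _ => ⟨l, rfl⟩) (fun _ => Iff.rfl) fun k _ => ?_
  exact (induces_lam s).smul_J_eq fun v => by simp

theorem chi_diag_smul_normSurface {a d : K} {μ : K ≃+* K} (h : a * d - 0 * 0 ≠ 0)
    {τ : F ≃+* F} (hτ : ∀ f, algebraMap F K (τ f) = μ (algebraMap F K f)) {α : Fˣ}
    (hα : Algebra.norm F a = α * Algebra.norm F d) (σ : K ≃ₐ[F] K) (f : Fˣ) :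
    chi F a 0 0 d μ h • normSurface σ f = normSurface σ (xi 1 α τ f) := by
  have hd : d ≠ 0 := by rintro rfl; simp at h
  have ha : a ≠ 0 := by rintro rfl; simp at h
  have hσd : σ d ≠ 0 := by simpa using hd
  have hNd : Algebra.norm F d ≠ 0 := by simpa using hd
  -- If x = k σ(y), then a x^μ = a σ(d)⁻¹ k^μ · σ(d y^μ), because σ and μ commute.
  refine smul_normSurface_eq (fun k => a * (σ d)⁻¹ * μ k)
    (fun l _ => ⟨μ.symm (a⁻¹ * σ d * l), ?_⟩) (fun k => ?_) fun k _ => (induces_chi h).smul_J_eq fun v => ?_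
  · simp only [RingEquiv.apply_symm_apply]
    field_simp
  · rw [map_mul, map_mul, Algebra.norm_inv, norm_algEquiv, norm_ringEquiv hτ, hα,
      mul_inv_cancel_right₀ hNd, xi_apply]
    simp
  · simp only [chiFun, zero_mul, add_zero, zero_add, map_mul]
    rw [← μ.injective.eq_iff (a := v.1), map_mul, ← algEquiv_ringEquiv_comm,
      ← mul_right_inj' ha (b := μ v.1)]
    field_simp

theorem chi_anti_smul_normSurface {b c : K} {μ : K ≃+* K} (h : 0 * 0 - b * c ≠ 0)
    {τ : F ≃+* F} (hτ : ∀ f, algebraMap F K (τ f) = μ (algebraMap F K f)) {α : Fˣ}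
    (hα : Algebra.norm F c = α * Algebra.norm F b) (σ : K ≃ₐ[F] K) (f : Fˣ) :
    chi F 0 b c 0 μ h • normSurface σ f = normSurface σ⁻¹ (xi (-1) α τ f) := by
  have hb : b ≠ 0 := by rintro rfl; simp at h
  have hc : c ≠ 0 := by rintro rfl; simp at h
  have hNb : Algebra.norm F b ≠ 0 := by simpa using hb
  -- From x = k σ(y) one gets b x^μ = b k^μ σ(y^μ). Applying σ⁻¹ and solving for c y^μ gives this
  -- parameter, with both σ and k inverted.
  refine smul_normSurface_eq (fun k => c / σ⁻¹ (b * μ k))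
    (fun l hl => ⟨μ.symm (b⁻¹ * σ (c / l)), ?_⟩) (fun k => ?_)
    fun k hk => (induces_chi h).smul_J_eq fun v => ?_
  · simp only [RingEquiv.apply_symm_apply]
    rw [mul_inv_cancel_left₀ hb, AlgEquiv.aut_inv, AlgEquiv.symm_apply_apply]
    field_simp
  · rw [div_eq_mul_inv, map_mul, Algebra.norm_inv, norm_algEquiv, map_mul, norm_ringEquiv hτ, hα,
      mul_inv, mul_assoc, mul_inv_cancel_left₀ hNb, xi_apply]
    simp
  · have hμk : μ k ≠ 0 := by simpa using hk
    have hkey : v.1 = k * σ v.2 ↔ b * μ v.1 = b * μ k * σ (μ v.2) := by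
      rw [← μ.injective.eq_iff, map_mul, algEquiv_ringEquiv_comm, mul_assoc, mul_right_inj' hb]
    rw [hkey, ← (σ⁻¹).injective.eq_iff (a := b * μ v.1), map_mul σ⁻¹ (b * μ k),
      ← AlgEquiv.mul_apply, inv_mul_cancel, AlgEquiv.one_apply]
    have : σ⁻¹ (b * μ k) ≠ 0 := by simp [hb, hk]
    simp only [chiFun, zero_mul, add_zero, zero_add]
    rw [div_mul_eq_mul_div, eq_div_iff this, mul_assoc, mul_right_inj' hc, mul_comm, eq_comm]

end Action

/-! ### Action isomorphisms from matching permutations -/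

section ActionIso

/-- Conjugation by `e` is already an isomorphism of symmetric groups, so it suffices that it carries
the induced permutation group onto `H`. -/
theorem isActionIso_of_forall_exists {G X Y : Type*} [Group G] [MulAction G X]
    {H : Subgroup (Equiv.Perm Y)} {e : X ≃ Y}
    (h₁ : ∀ g : G, ∃ π ∈ H, ∀ x, e (g • x) = π (e x))
    (h₂ : ∀ π ∈ H, ∃ g : G, ∀ x, e (g • x) = π (e x)) : IsActionIso G H e := by
  have hmap : (MulAction.toPermHom G X).range.map (e.permCongrHom : Equiv.Perm X →* Equiv.Perm Y)
      = H := by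
    have key : ∀ (g : G) (π : Equiv.Perm Y), (∀ x, e (g • x) = π (e x)) →
        e.permCongrHom (MulAction.toPermHom G X g) = π := by
      intro g π h
      ext y
      simpa using h (e.symm y)
    ext π
    constructor
    · rintro ⟨_, ⟨g, rfl⟩, rfl⟩
      obtain ⟨π, hπ, h⟩ := h₁ g
      have := key g π h
      change e.permCongrHom _ ∈ H
      rwa [this]
    · intro hπ
      obtain ⟨g, h⟩ := h₂ π hπ
      exact ⟨_, ⟨g, rfl⟩, key g π h⟩
  refine ⟨((e.permCongrHom).subgroupMap _).trans (MulEquiv.subgroupCongr hmap), fun π x => ?_⟩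
  change _ = e.permCongrHom (π : Equiv.Perm X) (e x)
  simp

variable {Γ X ι : Type*} [Group Γ] [MulAction Γ X] {N : ι → X}

theorem smul_range_eq {g : Γ} {π : Equiv.Perm ι} (h : ∀ i, g • N i = N (π i)) :
    g • Set.range N = Set.range N := by
  ext x
  constructor
  · rintro ⟨_, ⟨i, rfl⟩, rfl⟩
    exact ⟨π i, (h i).symm⟩
  · rintro ⟨i, rfl⟩
    exact ⟨_, ⟨π.symm i, rfl⟩, by simpa using h (π.symm i)⟩

theorem exists_equiv_isActionIso (hN : Function.Injective N) {C : Set Γ}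
    {H : Subgroup (Equiv.Perm ι)}
    (hC : (MulAction.stabilizer Γ (Set.range N) : Set Γ) = C)
    (h₁ : ∀ g ∈ C, ∃ π ∈ H, ∀ i, g • N i = N (π i))
    (h₂ : ∀ π ∈ H, ∃ g ∈ C, ∀ i, g • N i = N (π i)) :
    ∃ e : Set.range N ≃ ι, (∀ i, (e.symm i : X) = N i) ∧
      IsActionIso (MulAction.stabilizer Γ (Set.range N)) H e := by
  let e : Set.range N ≃ ι := (Equiv.ofInjective N hN).symm
  have key : ∀ (g : MulAction.stabilizer Γ (Set.range N)) (π : Equiv.Perm ι),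
      (∀ i, (g : Γ) • N i = N (π i)) → ∀ x, e (g • x) = π (e x) := by
    intro g π h x
    obtain ⟨i, rfl⟩ := e.symm.surjective x
    rw [e.apply_symm_apply, ← Equiv.eq_symm_apply]
    exact Subtype.ext (h i)
  refine ⟨e, fun _ => rfl, isActionIso_of_forall_exists (fun g => ?_) fun π hπ => ?_⟩
  · obtain ⟨π, hπ, h⟩ := h₁ g (hC ▸ g.2)
    exact ⟨π, hπ, key g π h⟩
  · obtain ⟨g, hg, h⟩ := h₂ π hπ
    exact ⟨⟨g, by rwa [← hC] at hg⟩, key ⟨g, _⟩ π h⟩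

end ActionIso

/-! ### The points covered by the norm surfaces -/

section OffAxes

/-- The points off the two subspaces `x = 0` and `y = 0`. -/
def offAxes (F K : Type*) [Field F] [Field K] [Algebra F K] : Set (ℙ F (K × K)) :=
  {p | ∃ (σ : K ≃ₐ[F] K) (k : K), k ≠ 0 ∧ p ∈ J σ k}

variable {F K : Type*} [Field F] [Field K] [Algebra F K]

theorem mk_mem_offAxes_iff {v : K × K} {hv : v ≠ 0} :
    mk F v hv ∈ offAxes F K ↔ v.1 ≠ 0 ∧ v.2 ≠ 0 := by
  constructor
  · rintro ⟨σ, k, hk, h⟩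
    rw [mk_mem_J] at h
    have h2 : v.2 ≠ 0 := by
      intro h2
      rw [h2, map_zero, mul_zero] at h
      exact hv (Prod.ext h h2)
    exact ⟨by simp [h, hk, h2], h2⟩
  · rintro ⟨h1, h2⟩
    exact ⟨1, v.1 / v.2, div_ne_zero h1 h2, mk_mem_J.2 (by simp [h2])⟩

end OffAxes

/-! ### Permutations of the surfaces induced by χ and λ -/

section Collineations

variable {F K : Type*} [Field F] [Field K] [Finite K] [Algebra F K]

theorem exists_xi_of_mem_collL {φ : Collineation F (K × K)} (hφ : φ ∈ collL F K) :
    ∃ (ε : ℤˣ) (α : Fˣ) (τ : F ≃+* F), ∀ (σ : K ≃ₐ[F] K) (f : Fˣ),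
      φ • normSurface σ f = normSurface (σ ^ (ε : ℤ)) (xi ε α τ f) := by
  have ratio : ∀ a d : K, a ≠ 0 → d ≠ 0 → ∃ α : Fˣ,
      Algebra.norm F a = α * Algebra.norm F d := by
    intro a d ha hd
    have ha' : Algebra.norm F a ≠ 0 := by simpa using ha
    have hd' : Algebra.norm F d ≠ 0 := by simpa using hd
    exact ⟨Units.mk0 _ (div_ne_zero ha' hd'), by simp [hd']⟩
  obtain ⟨a, d, μ, h, rfl⟩ | ⟨b, c, μ, h, rfl⟩ := hφ
  · obtain ⟨τ, hτ⟩ := exists_restrict_equiv F μ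
    obtain ⟨α, hα⟩ := ratio a d (by rintro rfl; simp at h) (by rintro rfl; simp at h)
    exact ⟨1, α, τ, fun σ f => by simpa using chi_diag_smul_normSurface h hτ hα σ f⟩
  · obtain ⟨τ, hτ⟩ := exists_restrict_equiv F μ
    obtain ⟨α, hα⟩ := ratio c b (by rintro rfl; simp at h) (by rintro rfl; simp at h)
    exact ⟨-1, α, τ, fun σ f => by simpa using chi_anti_smul_normSurface h hτ hα σ f⟩

theorem exists_mem_collL (ε : ℤˣ) (α : Fˣ) (τ : F ≃+* F) :
    ∃ φ ∈ collL F K, ∀ (σ : K ≃ₐ[F] K) (f : Fˣ),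
      φ • normSurface σ f = normSurface (σ ^ (ε : ℤ)) (xi ε α τ f) := by
  obtain ⟨μ, hτ⟩ := exists_extend_equiv K τ
  obtain ⟨a, ha, ha0⟩ := exists_norm_eq K α
  obtain rfl | rfl := Int.units_eq_one_or ε
  · have h : a * 1 - 0 * 0 ≠ 0 := by simpa using ha0
    exact ⟨_, Or.inl ⟨a, 1, μ, h, rfl⟩, fun σ f => by
      simpa using chi_diag_smul_normSurface h hτ (by simpa using ha) σ f⟩
  · have h : 0 * 0 - 1 * a ≠ 0 := by simpa using ha0
    exact ⟨_, Or.inr ⟨1, a, μ, h, rfl⟩, fun σ f => by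
      simpa using chi_anti_smul_normSurface h hτ (by simpa using ha) σ f⟩

theorem exists_xi_mem_of_mem_collL {φ : Collineation F (K × K)} (hφ : φ ∈ collL F K) :
    ∃ π ∈ Xi F, ∀ f : Fˣ,
      φ • normSurface (1 : K ≃ₐ[F] K) f = normSurface (1 : K ≃ₐ[F] K) (π f) := by
  obtain ⟨ε, α, τ, h⟩ := exists_xi_of_mem_collL hφ
  exact ⟨xi ε α τ, ⟨ε, α, τ, rfl⟩, fun f => by simpa using h 1 f⟩

theorem exists_upsilon_mem_of_mem_collJ {φ : Collineation F (K × K)} (hφ : φ ∈ collJ F K) :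
    ∃ π ∈ Upsilon F K, ∀ x : (K ≃ₐ[F] K) × Fˣ,
      φ • normSurface x.1 x.2 = normSurface (π x).1 (π x).2 := by
  obtain ⟨χ, hχ, σ, rfl⟩ := hφ
  obtain ⟨ε, α, τ, h⟩ := exists_xi_of_mem_collL hχ
  refine ⟨upsilon ε α τ σ, ⟨ε, α, τ, σ, rfl⟩, fun x => ?_⟩
  rw [mul_smul, h, lam_smul_normSurface]
  rfl

theorem exists_mem_collJ {π : Equiv.Perm ((K ≃ₐ[F] K) × Fˣ)} (hπ : π ∈ Upsilon F K) :
    ∃ φ ∈ collJ F K, ∀ x : (K ≃ₐ[F] K) × Fˣ,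
      φ • normSurface x.1 x.2 = normSurface (π x).1 (π x).2 := by
  obtain ⟨ε, α, τ, σ, rfl⟩ := hπ
  obtain ⟨χ, hχ, h⟩ := exists_mem_collL (K := K) ε α τ
  refine ⟨lam σ * χ, ⟨χ, hχ, σ, rfl⟩, fun x => ?_⟩
  rw [mul_smul, h, lam_smul_normSurface]
  rfl

end Collineations

/-! ### Determination of the stabilizers -/

section Rigidity

variable {F K : Type*} [Field F] [Field K] [Algebra F K]

/-- A group is not the union of two proper subgroups, here the kernels of the two components. -/
theorem forall_fst_eq_zero_or_forall_snd_eq_zero {A B C : Type*} [AddGroup A] [AddGroup B]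
    [AddGroup C] (g : A →+ B × C) (h : ∀ x, (g x).1 = 0 ∨ (g x).2 = 0) :
    (∀ x, (g x).1 = 0) ∨ ∀ x, (g x).2 = 0 := by
  by_contra! hcon
  obtain ⟨⟨x, hx⟩, y, hy⟩ := hcon
  have hx2 := (h x).resolve_left hx
  have hy1 := (h y).resolve_right hy
  have := h (x + y)
  simp [hx2, hy1, hx, hy] at this

theorem diag_or_anti {T : K × K →+ K × K}
    (hT : ∀ v, v ≠ 0 → ((T v).1 ≠ 0 ∧ (T v).2 ≠ 0 ↔ v.1 ≠ 0 ∧ v.2 ≠ 0)) :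
    (∀ v, T v = ((T (v.1, 0)).1, (T (0, v.2)).2)) ∨
      ∀ v, T v = ((T (0, v.2)).1, (T (v.1, 0)).2) := by
  have hax : ∀ v : K × K, v.1 = 0 ∨ v.2 = 0 → (T v).1 = 0 ∨ (T v).2 = 0 := by
    intro v hv
    by_cases hv0 : v = 0
    · simp [hv0]
    · have := hT v hv0
      tauto
  have hsum : ∀ v, T v = T (v.1, 0) + T (0, v.2) := fun v => by rw [← map_add]; simp
  have h1 := forall_fst_eq_zero_or_forall_snd_eq_zero (T.comp (AddMonoidHom.inl K K))
    fun x => hax _ (Or.inr rfl)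
  have h2 := forall_fst_eq_zero_or_forall_snd_eq_zero (T.comp (AddMonoidHom.inr K K))
    fun x => hax _ (Or.inl rfl)
  simp only [AddMonoidHom.comp_apply, AddMonoidHom.inl_apply, AddMonoidHom.inr_apply] at h1 h2
  -- This excludes that both axes are mapped into the same axis.
  have h11 : (T (1, 1)).1 ≠ 0 ∧ (T (1, 1)).2 ≠ 0 := (hT (1, 1) (by simp)).2 (by simp)
  rw [hsum] at h11
  simp only [Prod.fst_add, Prod.snd_add] at h11
  rcases h1 with h1 | h1 <;> rcases h2 with h2 | h2
  · simp [h1, h2] at h11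
  · exact Or.inr fun v => by rw [hsum v]; ext <;> simp [h1, h2]
  · exact Or.inl fun v => by rw [hsum v]; ext <;> simp [h1, h2]
  · simp [h1, h2] at h11

variable [Finite K]

/-- If `B` normalizes the multiplications by the elements of norm one, then `B` is
`K`-semilinear. -/
theorem exists_eq_mul_ringEquiv (hdim : 2 ≤ Module.finrank F K) {τ : F →+* F} (B : K →ₛₗ[τ] K)
    (hB1 : B 1 ≠ 0) (hB : ∀ e : K, Algebra.norm F e = 1 → ∃ l, ∀ x, B (e * x) = l * B x) :
    ∃ μ : K ≃+* K, ∀ x, B x = B 1 * μ x := by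
  let S : Submodule F K :=
    { carrier := {k | ∃ l, ∀ x, B (k * x) = l * B x}
      zero_mem' := ⟨0, by simp⟩
      add_mem' := by
        rintro a b ⟨l, hl⟩ ⟨m, hm⟩
        exact ⟨l + m, fun x => by rw [add_mul, map_add, hl, hm, add_mul]⟩
      smul_mem' := by
        rintro c a ⟨l, hl⟩
        exact ⟨τ c • l, fun x => by rw [smul_mul_assoc, map_smulₛₗ, hl, smul_mul_assoc]⟩ }
  have hS : S = ⊤ := eq_top_of_norm_one_mem hdim S hB
  -- Every k is now a multiplier; its factor is read off at x = 1, so B/B(1) is multiplicative.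
  have hmul : ∀ k x, B (k * x) = B k / B 1 * B x := by
    intro k x
    obtain ⟨l, hl⟩ : k ∈ S := hS ▸ Submodule.mem_top
    have := hl 1
    rw [mul_one] at this
    rw [hl, this, mul_div_cancel_right₀ _ hB1]
  let μ : K →+* K :=
    { toFun := fun k => B k / B 1
      map_one' := div_self hB1
      map_zero' := by simp
      map_mul' := fun a b => by rw [hmul, mul_div_assoc]
      map_add' := fun a b => by rw [map_add, add_div] }
  exact ⟨RingEquiv.ofBijective μ (Finite.injective_iff_bijective.1 μ.injective),
    fun x => (mul_div_cancel₀ _ hB1).symm⟩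

theorem eq_lam_mul_chi_of_diag (hdim : 2 ≤ Module.finrank F K) {φ : Collineation F (K × K)}
    {τ : F →+* F} {T : K × K →ₛₗ[τ] K × K} (hφ : Induces φ T)
    (hT : ∀ v, T v = ((T (v.1, 0)).1, (T (0, v.2)).2)) {ρ : K ≃ₐ[F] K} {f : Fˣ}
    (hN : φ • normSurface (1 : K ≃ₐ[F] K) 1 = normSurface ρ f) :
    ∃ (a d : K) (μ : K ≃+* K) (h : a * d - 0 * 0 ≠ 0), φ = lam ρ⁻¹ * chi F a 0 0 d μ h := by
  have h0 : ∀ v, T v = 0 → v = 0 := fun v hv => by_contra fun hv0 => (hφ v hv0).1 hv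
  let A : K →ₛₗ[τ] K := (LinearMap.fst F K K).comp (T.comp (LinearMap.inl F K K))
  let B : K →ₛₗ[τ] K := (LinearMap.snd F K K).comp (T.comp (LinearMap.inr F K K))
  have hAB : ∀ v, T v = (A v.1, B v.2) := hT
  have hB1 : B 1 ≠ 0 := by
    intro h
    have := h0 (0, 1) (by rw [hAB]; simp [h])
    simp at this
  have hA1 : A 1 ≠ 0 := by
    intro h
    have := h0 (1, 0) (by rw [hAB]; simp [h])
    simp at this
  have hmap : ∀ e : K, Algebra.norm F e = 1 → ∃ l, ∀ x, A (e * x) = l * ρ (B x) := by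
    intro e he
    obtain ⟨l, -, hl⟩ : φ • J (1 : K ≃ₐ[F] K) e ∈ normSurface ρ f :=
      hN ▸ Set.smul_mem_smul_set ⟨e, by simpa using he, rfl⟩
    refine ⟨l, fun x => ?_⟩
    by_cases hx : x = 0
    · simp [hx]
    have hv : (e * x, x) ≠ (0 : K × K) := by simp [hx]
    obtain ⟨hw, h⟩ := hφ _ hv
    have hmem : φ • mk F _ hv ∈ J ρ l :=
      hl ▸ Set.smul_mem_smul_set (mk_mem_J.2 (by simp))
    rw [h, mk_mem_J, hAB] at hmem
    exact hmem
  obtain ⟨l₁, hl₁⟩ := hmap 1 (map_one _)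
  simp only [one_mul] at hl₁
  have hl₁0 : l₁ ≠ 0 := by
    rintro rfl
    exact hA1 (by simpa using hl₁ 1)
  obtain ⟨μ, hμ⟩ := exists_eq_mul_ringEquiv hdim B hB1 (by
    intro e he
    obtain ⟨l, hl⟩ := hmap e he
    refine ⟨ρ⁻¹ (l₁⁻¹ * l), fun x => ρ.injective ?_⟩
    rw [map_mul ρ, AlgEquiv.aut_inv, AlgEquiv.apply_symm_apply, ← mul_right_inj' hl₁0, ← hl₁, hl]
    field_simp)
  have h : l₁ * ρ (B 1) * ρ (B 1) - 0 * 0 ≠ 0 := by simp [hl₁0, hB1]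
  refine ⟨l₁ * ρ (B 1), ρ (B 1), μ.trans ρ.toRingEquiv, h, hφ.eq ?_⟩
  convert (induces_lam ρ⁻¹).mul (induces_chi h) using 1
  funext v
  rw [hAB]
  ext
  · simp [chiFun, hl₁, hμ v.1, mul_assoc]
  · simp [chiFun, hμ v.2]

theorem chi_diag_mul_swap {a d : K} {μ : K ≃+* K} (h : a * d - 0 * 0 ≠ 0)
    (h' : 0 * 0 - d * a ≠ 0) (hs : (0 : K) * 0 - 1 * 1 ≠ 0) :
    chi F a 0 0 d μ h * chi F 0 1 1 0 (RingEquiv.refl K) hs = chi F 0 d a 0 μ h' := by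
  refine ((induces_chi h).mul (induces_chi hs)).eq ?_
  convert induces_chi (F := F) h' using 1
  funext v
  simp [chiFun]

theorem swap_mul_swap (hs : (0 : K) * 0 - 1 * 1 ≠ 0) :
    chi F 0 1 1 0 (RingEquiv.refl K) hs * chi F 0 1 1 0 (RingEquiv.refl K) hs = 1 := by
  have h := (induces_chi (F := F) (μ := RingEquiv.refl K) hs).mul
    (induces_chi (μ := RingEquiv.refl K) hs)
  have : chiFun 0 1 1 0 (RingEquiv.refl K) ∘ chiFun 0 1 1 0 (RingEquiv.refl K) = id := by
    funext v
    simp [chiFun]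
  rw [this] at h
  exact h.eq fun v hv => ⟨hv, one_smul ..⟩

theorem exists_eq_lam_mul (hdim : 2 ≤ Module.finrank F K) {φ : Collineation F (K × K)}
    (hφ : ∀ p, φ • p ∈ offAxes F K ↔ p ∈ offAxes F K) {ρ : K ≃ₐ[F] K} {f : Fˣ}
    (hN : φ • normSurface (1 : K ≃ₐ[F] K) 1 = normSurface ρ f) :
    ∃ χ ∈ collL F K, φ = lam ρ⁻¹ * χ := by
  have : Finite F := Finite.of_injective _ (algebraMap F K).injective
  obtain ⟨τ, T, hT⟩ : ∃ (τ : F →+* F) (T : K × K →ₛₗ[τ] K × K), Induces φ T :=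
    Collineation.exists_semilinear φ (by rw [Module.finrank_prod]; omega)
  have hoff : ∀ v, v ≠ 0 → ((T v).1 ≠ 0 ∧ (T v).2 ≠ 0 ↔ v.1 ≠ 0 ∧ v.2 ≠ 0) := by
    intro v hv
    obtain ⟨hw, h⟩ := hT v hv
    rw [← mk_mem_offAxes_iff (F := F) (hv := hw), ← h, hφ, mk_mem_offAxes_iff]
  obtain h | h := diag_or_anti (T := T.toAddMonoidHom) hoff
  · obtain ⟨a, d, μ, h', e⟩ := eq_lam_mul_chi_of_diag hdim hT h hN
    exact ⟨_, Or.inl ⟨a, d, μ, h', rfl⟩, e⟩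
  · have hs : (0 : K) * 0 - 1 * 1 ≠ 0 := by simp
    let s : K × K →ₗ[F] K × K := (LinearEquiv.prodComm F K K).toLinearMap
    have hswap : Induces (chi F 0 1 1 0 (RingEquiv.refl K) hs) s := by
      convert induces_chi (F := F) hs using 1
      funext v
      simp [chiFun, s, Prod.ext_iff]
    have hTs : Induces (φ * chi F 0 1 1 0 (RingEquiv.refl K) hs) (T.comp s) := hT.mul hswap
    have hNs : (φ * chi F 0 1 1 0 (RingEquiv.refl K) hs) • normSurface (1 : K ≃ₐ[F] K) 1 =
        normSurface ρ f := by
      rw [mul_smul, chi_anti_smul_normSurface hs (τ := RingEquiv.refl F) (α := 1) (by simp)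
        (by simp), ← hN]
      congr 1
      rw [inv_one]
      congr 1
      ext
      simp [xi_apply]
    obtain ⟨a, d, μ, h', e⟩ := eq_lam_mul_chi_of_diag hdim hTs (fun v => h (v.2, v.1)) hNs
    have h'' : 0 * 0 - d * a ≠ 0 := by simpa [mul_comm] using h'
    refine ⟨_, Or.inr ⟨d, a, μ, h'', rfl⟩, ?_⟩
    rw [← chi_diag_mul_swap h' h'' hs, ← mul_assoc, ← e, mul_assoc, swap_mul_swap, mul_one]

theorem exists_eq_lam_mul_of_smul_eq (hdim : 2 ≤ Module.finrank F K)
    {S : Set (Set (Set (ℙ F (K × K))))} (hS₁ : linearSet F K ⊆ S) (hS₂ : S ⊆ allSurfaces F K)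
    {φ : Collineation F (K × K)} (hφ : φ • S = S) :
    ∃ (ρ : K ≃ₐ[F] K) (f : Fˣ), normSurface ρ f ∈ S ∧ ∃ χ ∈ collL F K, φ = lam ρ⁻¹ * χ := by
  have hoff : ∀ ψ : Collineation F (K × K), ψ • S = S → ∀ p ∈ offAxes F K,
      ψ • p ∈ offAxes F K := by
    intro ψ hψ p hp
    induction p using Projectivization.ind with | h v hv =>
    obtain ⟨h1, h2⟩ := mk_mem_offAxes_iff.1 hp
    have hk : Algebra.norm F (v.1 / v.2) ≠ 0 := by simp [h1, h2]
    have hmem : normSurface (1 : K ≃ₐ[F] K) (Units.mk0 _ hk) ∈ S := hS₁ ⟨_, rfl⟩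
    obtain ⟨⟨σ, g⟩, hg⟩ := hS₂ (hψ ▸ Set.smul_mem_smul_set (a := ψ) hmem)
    have hJ : ψ • J (1 : K ≃ₐ[F] K) (v.1 / v.2) ∈ normSurface σ g := by
      change _ = _ at hg
      simp only at hg
      rw [hg]
      exact Set.smul_mem_smul_set ⟨_, rfl, rfl⟩
    obtain ⟨l, hl, hl'⟩ := hJ
    refine ⟨σ, l, ?_, hl' ▸ Set.smul_mem_smul_set (mk_mem_J.2 (by simp [h2]))⟩
    rintro rfl
    rw [Algebra.norm_zero] at hl
    exact g.ne_zero hl.symm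
  have hmem : φ • normSurface (1 : K ≃ₐ[F] K) 1 ∈ S :=
    hφ ▸ Set.smul_mem_smul_set (a := φ) (hS₁ ⟨1, rfl⟩)
  obtain ⟨⟨ρ, f⟩, hρ⟩ := hS₂ hmem
  refine ⟨ρ, f, by rwa [← hρ] at hmem, exists_eq_lam_mul hdim (fun p => ⟨fun h => ?_, hoff φ hφ p⟩) hρ.symm⟩
  simpa using hoff φ⁻¹ (inv_smul_eq_iff.2 hφ.symm) _ h

theorem lam_one : lam (1 : K ≃ₐ[F] K) = 1 :=
  (induces_lam 1).eq fun v hv => ⟨by simpa using hv, by simp⟩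

theorem stabilizer_linearSet (hdim : 2 ≤ Module.finrank F K) :
    (MulAction.stabilizer (Collineation F (K × K)) (linearSet F K) :
      Set (Collineation F (K × K))) = collL F K := by
  ext φ
  rw [SetLike.mem_coe, MulAction.mem_stabilizer_iff]
  constructor
  · intro h
    obtain ⟨ρ, f, ⟨g, hg⟩, χ, hχ, rfl⟩ := exists_eq_lam_mul_of_smul_eq hdim subset_rfl
      (by rintro _ ⟨f, rfl⟩; exact ⟨(1, f), rfl⟩) h
    obtain ⟨rfl, -⟩ := normSurface_injective hg
    rwa [inv_one, lam_one, one_mul]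
  · intro h
    obtain ⟨π, -, hπ⟩ := exists_xi_mem_of_mem_collL h
    exact smul_range_eq hπ

theorem stabilizer_allSurfaces (hdim : 2 ≤ Module.finrank F K) :
    (MulAction.stabilizer (Collineation F (K × K)) (allSurfaces F K) :
      Set (Collineation F (K × K))) = collJ F K := by
  ext φ
  rw [SetLike.mem_coe, MulAction.mem_stabilizer_iff]
  constructor
  · intro h
    obtain ⟨ρ, -, -, χ, hχ, rfl⟩ := exists_eq_lam_mul_of_smul_eq hdim
      (by rintro _ ⟨f, rfl⟩; exact ⟨(1, f), rfl⟩) subset_rfl h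
    exact ⟨χ, hχ, ρ⁻¹, rfl⟩
  · intro h
    obtain ⟨π, -, hπ⟩ := exists_upsilon_mem_of_mem_collJ h
    exact smul_range_eq hπ

end Rigidity

end Andre

theorem theorem2p4 {F K : Type*} [Field F] [Field K] [Finite F] [Finite K] [Algebra F K]
    (n q : ℕ) (hn : 1 ≤ n) (hq : 2 < q) (hnq : (n, q) ≠ (1, 3))
    (hF : Nat.card F = q) (hK : Module.finrank F K = n + 1) :
    (MulAction.stabilizer (Andre.Collineation F (K × K)) (Andre.linearSet F K) :
        Set (Andre.Collineation F (K × K))) = Andre.collL F K ∧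
    (∃ e : Andre.linearSet F K ≃ Fˣ,
      (∀ f : Fˣ, (e.symm f : Set (Set (ℙ F (K × K)))) = Andre.normSurface 1 f) ∧
      Andre.IsActionIso
        (MulAction.stabilizer (Andre.Collineation F (K × K)) (Andre.linearSet F K))
        (Andre.Xi F) e) ∧
    (MulAction.stabilizer (Andre.Collineation F (K × K)) (Andre.allSurfaces F K) :
        Set (Andre.Collineation F (K × K))) = Andre.collJ F K ∧
    (∃ e : Andre.allSurfaces F K ≃ (K ≃ₐ[F] K) × Fˣ,
      (∀ (ρ : K ≃ₐ[F] K) (f : Fˣ),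
        (e.symm (ρ, f) : Set (Set (ℙ F (K × K)))) = Andre.normSurface ρ f) ∧
      Andre.IsActionIso
        (MulAction.stabilizer (Andre.Collineation F (K × K)) (Andre.allSurfaces F K))
        (Andre.Upsilon F K) e) := by
  have hdim : 2 ≤ Module.finrank F K := by omega
  refine ⟨Andre.stabilizer_linearSet hdim, ?_, Andre.stabilizer_allSurfaces hdim, ?_⟩
  · refine Andre.exists_equiv_isActionIso
      (fun f g h => (Andre.normSurface_injective h).2) (Andre.stabilizer_linearSet hdim)
      (fun φ hφ => Andre.exists_xi_mem_of_mem_collL hφ) ?_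
    rintro _ ⟨ε, α, τ, rfl⟩
    obtain ⟨φ, hφ, h⟩ := Andre.exists_mem_collL (K := K) ε α τ
    exact ⟨φ, hφ, fun f => by simpa using h 1 f⟩
  · obtain ⟨e, he, hiso⟩ := Andre.exists_equiv_isActionIso
      (N := fun x : (K ≃ₐ[F] K) × Fˣ => Andre.normSurface x.1 x.2)
      (fun x y h => Prod.ext (Andre.normSurface_injective h).1 (Andre.normSurface_injective h).2)
      (Andre.stabilizer_allSurfaces hdim)
      (fun φ hφ => Andre.exists_upsilon_mem_of_mem_collJ hφ)
      (fun π hπ => Andre.exists_mem_collJ hπ)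
    exact ⟨e, fun ρ f => he (ρ, f), hiso⟩
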